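/- **Setting.** A *ball* in an ultrametric space is a set $\{y: d(x,y)\le r\}$, $r\ge 0$. A *maximal subball* of a ball $I$ is a ball properly contained in $I$ with no other ball strictly between the two. An ultrametric space $X$ is *regular* if (1) the set of balls of nonzero diameter is finite or countable; (2) along every strictly decreasing sequence of balls the diameters tend to zero; (3) every ball of nonzero diameter is a finite union of maximal subballs. Its *tree of balls* $\mathcal T(X)$ consists of all balls of nonzero diameter together with those balls of zero diameter that are maximal subballs of balls of nonzero diameter, partially ordered by inclusion. Let $X^1,\dots,X^n$ be regular ultrametric spaces and let $\nu^i$ be a nonzero Borel measure on $X^i$ that is finite on balls. Let $X=X^1\times\dots\times X^n$ and $\nu=\nu^1\times\dots\times\nu^n$. For a non-minimal vertex $I$ of $\mathcal T(X^i)$ let $V(I)\subset L^2(X^i,\nu^i)$ be the complex linear span of the characteristic functions of the maximal subballs of $I$, let $V^0(I)$ be the subspace of functions in $V(I)$ with zero $\nu^i$-mean, and let $\{\Psi_{Ij}\}_j$ be any orthonormal basis of $V^0(I)$. If $A_i=\nu^i(X^i)<\infty$, let $\widetilde{\mathcal T}(X^i)=\mathcal T(X^i)\cup\{K^{(i)}\}$,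 where $K^{(i)}$ is an added vertex larger than all others, to which the single function $\Psi_{K^{(i)}}=A_i^{-1/2}$ (a constant) is attached; if $\nu^i(X^i)=\infty$, let $\widetilde{\mathcal T}(X^i)=\mathcal T(X^i)$. The vertices of the hypergraph $\mathcal T$ (respectively of the augmented hypergraph $\widetilde{\mathcal T}$) are the tuples $\mathbf I=(I^1,\dots,I^n)$ with $I^k\in\mathcal T(X^k)$ (respectively $I^k\in\widetilde{\mathcal T}(X^k)$). The vertex $\mathbf I$ is *generic* if every $I^k$ is a non-minimal vertex of $\mathcal T(X^k)$ (respectively is a non-minimal vertex of $\mathcal T(X^k)$ or equals $K^{(k)}$). For generic $\mathbf I$ and $\mathbf j=(j^1,\dots,j^n)$ put $$\Psi_{\mathbf I\mathbf j}(x^1,\dots,x^n)=\prod_{k=1}^n\Psi_{I^kj^k}(x^k),$$ where the index $j^k$ takes a single value if $I^k=K^{(k)}$. **Theorem.** 1) If $\nu^i(X^i)=\infty$ for all $i=1,\dots,n$, then the family $\{\Psi_{\mathbf I\mathbf j}\}$, with $\mathbf I$ running over the generic vertices of $\mathcal T$ and $\mathbf j$ over the corresponding indices, is an orthonormal basis of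 $L^2(X,\nu)$. 2) If $\nu^i(X^i)<\infty$ for some $i$, then the family $\{\Psi_{\mathbf I\mathbf j}\}$, with $\mathbf I$ running over the generic vertices of $\widetilde{\mathcal T}$ and $\mathbf j$ over the corresponding indices, is an orthonormal basis of $L^2(X,\nu)$. -/

import Mathlib

open MeasureTheory Filter Topology

universe u w

namespace UltrametricWavelets

section Balls

variable {X : Type u} [MetricSpace X]

/-- A ball: a closed ball of some radius `r ≥ 0` around some point (`r = 0` gives the points,
which are the balls of zero diameter). In a regular ultrametric space every nonempty open ball
is also of this form. -/
def IsBall (s : Set X) : Prop :=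
  ∃ (x : X) (r : ℝ), 0 ≤ r ∧ s = Metric.closedBall x r

/-- `J` is a maximal subball of `I`: a ball properly contained in `I` such that no other ball
lies between `J` and `I`. -/
def IsMaximalSubball (J I : Set X) : Prop :=
  IsBall J ∧ J ⊂ I ∧ ∀ L : Set X, IsBall L → J ⊆ L → L ⊂ I → L = J

variable (X) in
/-- Regular ultrametric spaces. -/
structure IsRegularUltrametric : Prop where
  /-- the metric is an ultrametric -/
  ultrametric : IsUltrametricDist X
  /-- the set of balls of nonzero diameter is finite or countable -/
  countable_balls : {s : Set X | IsBall s ∧ 0 < Metric.diam s}.Countable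
  /-- along a (strictly) decreasing sequence of balls the diameters tend to zero -/
  diam_tendsto_zero : ∀ D : ℕ → Set X, (∀ k, IsBall (D k)) → (∀ k, D (k + 1) ⊂ D k) →
    Tendsto (fun k => Metric.diam (D k)) atTop (𝓝 0)
  /-- every ball of nonzero diameter is a finite union of maximal subballs -/
  finite_union : ∀ I : Set X, IsBall I → 0 < Metric.diam I →
    ∃ F : Set (Set X), F.Finite ∧ (∀ J ∈ F, IsMaximalSubball J I) ∧ I = ⋃₀ F

variable (X) in
/-- The (vertices of the) directed tree of balls `T(X)`: all balls of nonzero diameter, and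
those balls of zero diameter that are maximal subballs of balls of nonzero diameter. As a
subtype of `Set X` it carries the partial order given by inclusion. -/
abbrev BallTree : Type u :=
  {s : Set X // (IsBall s ∧ 0 < Metric.diam s) ∨
    (IsBall s ∧ Metric.diam s = 0 ∧
      ∃ I : Set X, IsBall I ∧ 0 < Metric.diam I ∧ IsMaximalSubball s I)}

variable (X) in
/-- The non-minimal vertices of the tree of balls. -/
abbrev NonminimalBall : Type u := {I : BallTree X // ¬ IsMin I}

end Balls

section WaveletSpace

variable {X : Type u} [MetricSpace X] [MeasurableSpace X]

/-- `V(I)`: the subspace of `L²(X, ν)` spanned by the characteristic functions of the maximal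
subballs of `I`. -/
noncomputable def ballSpace (ν : Measure X) (I : Set X) : Submodule ℂ (Lp ℂ 2 ν) :=
  Submodule.span ℂ {f : Lp ℂ 2 ν | ∃ J : Set X, IsMaximalSubball J I ∧
    ⇑f =ᵐ[ν] J.indicator (fun _ => (1 : ℂ))}

/-- `V⁰(I)`: the functions in `V(I)` with zero mean. When balls have finite measure, all
elements of `V(I)` are integrable, so that integrability is no restriction. -/
noncomputable def waveletSpace (ν : Measure X) (I : Set X) : Submodule ℂ (Lp ℂ 2 ν) where
  carrier := {f | f ∈ ballSpace ν I ∧ Integrable f ν ∧ ∫ x, f x ∂ν = 0}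
  zero_mem' := by
    refine ⟨Submodule.zero_mem _, ?_, ?_⟩
    · exact (integrable_zero X ℂ ν).congr (Lp.coeFn_zero ℂ 2 ν).symm
    · rw [integral_congr_ae (Lp.coeFn_zero ℂ 2 ν)]
      simp
  add_mem' := by
    rintro f g ⟨hf, hfi, hf0⟩ ⟨hg, hgi, hg0⟩
    refine ⟨Submodule.add_mem _ hf hg, (hfi.add hgi).congr (Lp.coeFn_add f g).symm, ?_⟩
    rw [integral_congr_ae (Lp.coeFn_add f g), integral_add' hfi hgi, hf0, hg0, add_zero]
  smul_mem' := by
    rintro c f ⟨hf, hfi, hf0⟩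
    refine ⟨Submodule.smul_mem _ c hf, (hfi.smul c).congr (Lp.coeFn_smul c f).symm, ?_⟩
    rw [integral_congr_ae (Lp.coeFn_smul c f)]
    simp only [Pi.smul_apply]
    rw [integral_smul, hf0, smul_zero]

end WaveletSpace

section Augmented

variable {X : Type u} [MetricSpace X] [MeasurableSpace X]

/-- The augmented tree: if `ν(X) < ∞`, a vertex `K = ⊤`, larger than all others, is added to the
tree of balls; if `ν(X) = ∞`, nothing is added. -/
abbrev AugmentedTree (ν : Measure X) : Type u :=
  {I : WithTop (BallTree X) // I = ⊤ → ν Set.univ < ⊤}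

/-- A vertex of the augmented tree is generic if it is the added vertex `K` or a non-minimal
vertex of the tree of balls. -/
def AugmentedTree.IsGeneric {ν : Measure X} (I : AugmentedTree ν) : Prop :=
  ∀ B : BallTree X, I.1 = (B : WithTop (BallTree X)) → ¬ IsMin B

/-- The index set of the wavelets at a generic vertex of the augmented tree: that of the given
basis of `V⁰(I)` at a ball `I`, and a single index at the added vertex. -/
def augmentedIndex {ν : Measure X} (J : NonminimalBall X → Type w) :
    (I : AugmentedTree ν) → AugmentedTree.IsGeneric I → Type w
  | ⟨none, _⟩, _ => PUnit
  | ⟨some B, _⟩, h => J ⟨B, h B rfl⟩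

/-- The wavelets on the augmented tree: the given orthonormal bases of the spaces `V⁰(I)` at the
balls, and the constant function `ν(X)^(-1/2)` at the added vertex. -/
noncomputable def augmentedWavelet {ν : Measure X} {J : NonminimalBall X → Type w}
    [∀ I, Fintype (J I)]
    (ψ : ∀ I : NonminimalBall X, OrthonormalBasis (J I) ℂ (waveletSpace ν I.1.1)) :
    (I : AugmentedTree ν) → (h : AugmentedTree.IsGeneric I) → augmentedIndex J I h → X → ℂ
  | ⟨none, _⟩, _, _ => fun _ => (((ν Set.univ).toReal ^ (-(1 / 2) : ℝ) : ℝ) : ℂ)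
  | ⟨some B, _⟩, h, j => ⇑(ψ ⟨B, h B rfl⟩ j : Lp ℂ 2 ν)

end Augmented

section Product

variable {n : ℕ} (X : Fin n → Type u) [∀ i, MetricSpace (X i)]

/-- The vertices of the hypergraph `T(X¹) × ⋯ × T(Xⁿ)`, with the product order. -/
abbrev HyperVertex : Type u := ∀ i, BallTree (X i)

variable {X} in
/-- A vertex of the hypergraph is generic if all its components are non-minimal. -/
def HyperVertex.IsGeneric (I : HyperVertex X) : Prop := ∀ i, ¬ IsMin (I i)

variable {X} [∀ i, MeasurableSpace (X i)]

/-- The vertices of the augmented hypergraph. -/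
abbrev AugmentedHyperVertex (ν : ∀ i, Measure (X i)) : Type u := ∀ i, AugmentedTree (ν i)

/-- A vertex of the augmented hypergraph is generic if all its components are generic. -/
def AugmentedHyperVertex.IsGeneric {ν : ∀ i, Measure (X i)} (I : AugmentedHyperVertex ν) : Prop :=
  ∀ i, AugmentedTree.IsGeneric (I i)

/-- The index set of pairs `(I, j)`: `I` a generic vertex of the hypergraph, `j = (j¹, …, jⁿ)`
with `jᵏ` an index of the orthonormal basis of `V⁰(Iᵏ)`. -/
abbrev WaveletIndex (J : ∀ i, NonminimalBall (X i) → Type w) : Type (max u w) :=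
  Σ I : {I : HyperVertex X // HyperVertex.IsGeneric I}, ∀ i, J i ⟨I.1 i, I.2 i⟩

/-- The same index set for the augmented hypergraph. -/
abbrev AugmentedWaveletIndex (ν : ∀ i, Measure (X i)) (J : ∀ i, NonminimalBall (X i) → Type w) :
    Type (max u w) :=
  Σ I : {I : AugmentedHyperVertex ν // AugmentedHyperVertex.IsGeneric I},
    ∀ i, augmentedIndex (J i) (I.1 i) (I.2 i)

/-- The multidimensional wavelet `Ψ_{Ij}(x) = ∏ₖ Ψ_{Iᵏjᵏ}(xᵏ)`. -/
noncomputable def multiWavelet {ν : ∀ i, Measure (X i)} {J : ∀ i, NonminimalBall (X i) → Type w}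
    [∀ i I, Fintype (J i I)]
    (ψ : ∀ i (I : NonminimalBall (X i)), OrthonormalBasis (J i I) ℂ (waveletSpace (ν i) I.1.1))
    (p : WaveletIndex J) (x : ∀ i, X i) : ℂ :=
  ∏ k, (ψ k ⟨p.1.1 k, p.1.2 k⟩ (p.2 k) : Lp ℂ 2 (ν k)) (x k)

/-- The multidimensional wavelets on the augmented hypergraph. -/
noncomputable def augmentedMultiWavelet {ν : ∀ i, Measure (X i)}
    {J : ∀ i, NonminimalBall (X i) → Type w} [∀ i I, Fintype (J i I)]
    (ψ : ∀ i (I : NonminimalBall (X i)), OrthonormalBasis (J i I) ℂ (waveletSpace (ν i) I.1.1))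
    (p : AugmentedWaveletIndex ν J) (x : ∀ i, X i) : ℂ :=
  ∏ k, augmentedWavelet (ψ k) (p.1.1 k) (p.1.2 k) (p.2 k) (x k)

end Product

end UltrametricWavelets

open UltrametricWavelets

/-! Products of Hilbert bases of the factors form a Hilbert basis of `L²` of the product
(`exists_hilbertBasis_pi`), so everything reduces to one regular ultrametric space. For the product,
inner products of tensors factor by Fubini. Totality holds because indicators of boxes of finite
measure are tensors, and every tensor is approximated from the basis tensors one factor at a time.

In one variable two balls are nested or disjoint. Disjoint balls give wavelets with disjoint
supports; if `I ⊂ L`, a wavelet of `L` is constant on `I`, where a wavelet of `I` has mean zero.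
This gives orthogonality (`inner_waveletSpace_eq_zero`).

For completeness, let `g` be orthogonal to all wavelets. Then `g` has equal means on a ball and on
its maximal subballs, hence on all nested balls (`setIntegral_mul_of_subset`). Comparing a fixed
ball with balls exhausting the space, the common mean is zero: for finite measure by orthogonality
to constants, for infinite measure because Cauchy–Schwarz bounds the mean on `B` by `‖g‖ / √(ν B)`
(`setIntegral_eq_zero_of_isBall`). Balls form a π-system generating the Borel σ-algebra
(`generateFrom_isBall`), so `g = 0`. -/

namespace UltrametricWavelets

/-! ### Vanishing of an `L²` function tested on a π-system. -/

section SetIntegral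

variable {α : Type*} {m : MeasurableSpace α} {μ : Measure α}

/-- A square integrable function whose integrals over the sets of finite measure in a spanning
generating π-system vanish is zero. -/
theorem Lp_eq_zero_of_forall_setIntegral_eq_zero {C : Set (Set α)}
    (hgen : m = MeasurableSpace.generateFrom C) (hpi : IsPiSystem C)
    (S : μ.FiniteSpanningSetsIn C) (g : Lp ℂ 2 μ)
    (hg : ∀ s ∈ C, μ s < ⊤ → ∫ x in s, g x ∂μ = 0) : g = 0 := by
  have hCm : ∀ s ∈ C, MeasurableSet s := fun s hs => by
    rw [hgen]; exact MeasurableSpace.measurableSet_generateFrom hs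
  have hint : ∀ k, IntegrableOn g (S.set k) μ := fun k =>
    integrableOn_Lp_of_measure_ne_top g one_le_two (S.finite k).ne
  -- `g` need not be integrable on the whole space, so the π-λ induction is run inside each spanning
  -- set, where it is integrable.
  have key : ∀ k, ∀ t, MeasurableSet t → ∫ x in t ∩ S.set k, g x ∂μ = 0 := by
    intro k
    refine MeasurableSpace.induction_on_inter hgen hpi (by simp) ?_ ?_ ?_
    · intro t ht
      rcases (t ∩ S.set k).eq_empty_or_nonempty with h | h
      · simp [h]
      · exact hg _ (hpi t ht _ (S.set_mem k) h)
          ((measure_mono Set.inter_subset_right).trans_lt (S.finite k))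
    · intro t ht h
      have h1 := integral_inter_add_sdiff (μ := μ) (f := g) ht (hint k)
      rw [Set.inter_comm, h, zero_add, hg _ (S.set_mem k) (S.finite k)] at h1
      rwa [Set.inter_comm, ← Set.sdiff_eq]
    · intro f hd hf h
      rw [Set.iUnion_inter, integral_iUnion]
      · simp [h]
      · exact fun i => (hf i).inter (hCm _ (S.set_mem k))
      · exact fun i j hij => (hd hij).mono Set.inter_subset_left Set.inter_subset_left
      · exact (hint k).mono_set (Set.iUnion_subset fun i => Set.inter_subset_right)
  have hk : ∀ k, ∀ᵐ x ∂(μ.restrict (S.set k)), g x = 0 := fun k => by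
    refine Integrable.ae_eq_zero_of_forall_setIntegral_eq_zero (hint k) fun t ht _ => ?_
    rw [Measure.restrict_restrict ht]
    exact key k t ht
  have : ∀ᵐ x ∂(μ.restrict (⋃ k, S.set k)), g x = 0 := by
    rw [ae_restrict_iUnion_eq]
    simpa using hk
  rw [S.spanning, Measure.restrict_univ] at this
  exact (Lp.eq_zero_iff_ae_eq_zero).2 this

end SetIntegral

/-! ### Tensor products of `L²` functions and of Hilbert bases. -/

section TensorProduct

variable {ι : Type*} [Fintype ι] {X : ι → Type*} [∀ i, MeasurableSpace (X i)]
  {ν : ∀ i, Measure (X i)} [∀ i, SigmaFinite (ν i)]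

theorem memLp_two_fintype_prod {f : ∀ i, X i → ℂ} (hf : ∀ i, MemLp (f i) 2 (ν i)) :
    MemLp (fun x : ∀ i, X i => ∏ i, f i (x i)) 2 (Measure.pi ν) := by
  rw [memLp_two_iff_integrable_sq_norm]
  · have := Integrable.fintype_prod_dep (𝕜 := ℝ) (f := fun i x => ‖f i x‖ ^ 2)
      fun i => (memLp_two_iff_integrable_sq_norm (hf i).1).1 (hf i)
    simpa only [norm_prod, ← Finset.prod_pow] using this
  · exact Finset.aestronglyMeasurable_fun_prod _ fun i _ =>
      (hf i).1.comp_quasiMeasurePreserving (Measure.quasiMeasurePreserving_eval ν i)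

theorem ae_eq_fintype_prod {f g : ∀ i, X i → ℂ} (h : ∀ i, f i =ᵐ[ν i] g i) :
    (fun x : ∀ i, X i => ∏ i, f i (x i)) =ᵐ[Measure.pi ν] fun x => ∏ i, g i (x i) := by
  have : ∀ i, ∀ᵐ x ∂(Measure.pi ν), f i (x i) = g i (x i) := fun i =>
    (Measure.quasiMeasurePreserving_eval ν i).ae (h i)
  filter_upwards [ae_all_iff.2 this] with x hx
  exact Finset.prod_congr rfl fun i _ => hx i

/-- The product of square integrable functions of separate variables. -/
noncomputable def tensorLp (f : ∀ i, Lp ℂ 2 (ν i)) : Lp ℂ 2 (Measure.pi ν) :=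
  (memLp_two_fintype_prod fun i => Lp.memLp (f i)).toLp _

theorem coeFn_tensorLp (f : ∀ i, Lp ℂ 2 (ν i)) :
    ⇑(tensorLp f) =ᵐ[Measure.pi ν] fun x => ∏ i, f i (x i) :=
  MemLp.coeFn_toLp _

theorem inner_tensorLp (f g : ∀ i, Lp ℂ 2 (ν i)) :
    inner ℂ (tensorLp f) (tensorLp g) = ∏ i, inner ℂ (f i) (g i) := by
  simp only [L2.inner_def]
  rw [← integral_fintype_prod_eq_prod]
  refine integral_congr_ae ?_
  filter_upwards [coeFn_tensorLp f, coeFn_tensorLp g] with x hf hg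
  simp [hf, hg, Finset.prod_mul_distrib]

theorem norm_tensorLp (f : ∀ i, Lp ℂ 2 (ν i)) : ‖tensorLp f‖ = ∏ i, ‖f i‖ := by
  have h := inner_tensorLp f f
  simp only [inner_self_eq_norm_sq_to_K] at h
  rw [Finset.prod_pow] at h
  have h2 : ‖tensorLp f‖ ^ 2 = (∏ i, ‖f i‖) ^ 2 := by exact_mod_cast h
  exact (pow_left_inj₀ (norm_nonneg _) (Finset.prod_nonneg fun _ _ => norm_nonneg _)
    two_ne_zero).1 h2

variable (ν) in
/-- `tensorLp` as a continuous multilinear map. -/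
noncomputable def tensorCLM :
    ContinuousMultilinearMap ℂ (fun i => Lp ℂ 2 (ν i)) (Lp ℂ 2 (Measure.pi ν)) :=
  MultilinearMap.mkContinuous
    { toFun := tensorLp
      map_update_add' := by
        intro _ f i a b
        refine Lp.ext ?_
        refine (coeFn_tensorLp _).trans (EventuallyEq.trans ?_ (Lp.coeFn_add _ _).symm)
        have hab := (Measure.quasiMeasurePreserving_eval ν i).ae (Lp.coeFn_add a b)
        filter_upwards [coeFn_tensorLp (Function.update f i a),
          coeFn_tensorLp (Function.update f i b), hab] with x ha hb hab
        have hupd : ∀ c : Lp ℂ 2 (ν i), ∏ j, (Function.update f i c j : X j → ℂ) (x j)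
            = c (x i) * ∏ j ∈ Finset.univ.erase i, f j (x j) := fun c => by
          rw [← Finset.mul_prod_erase _ _ (Finset.mem_univ i), Function.update_self]
          congr 1
          exact Finset.prod_congr rfl fun j hj => by
            rw [Function.update_of_ne (Finset.ne_of_mem_erase hj)]
        simp only [Function.eval] at hab
        rw [Pi.add_apply, ha, hb, hupd, hupd, hupd, hab, Pi.add_apply, add_mul]
      map_update_smul' := by
        intro _ f i c a
        refine Lp.ext ?_
        refine (coeFn_tensorLp _).trans (EventuallyEq.trans ?_ (Lp.coeFn_smul _ _).symm)
        have hab := (Measure.quasiMeasurePreserving_eval ν i).ae (Lp.coeFn_smul c a)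
        filter_upwards [coeFn_tensorLp (Function.update f i a), hab] with x ha hab
        have hupd : ∀ c : Lp ℂ 2 (ν i), ∏ j, (Function.update f i c j : X j → ℂ) (x j)
            = c (x i) * ∏ j ∈ Finset.univ.erase i, f j (x j) := fun c => by
          rw [← Finset.mul_prod_erase _ _ (Finset.mem_univ i), Function.update_self]
          congr 1
          exact Finset.prod_congr rfl fun j hj => by
            rw [Function.update_of_ne (Finset.ne_of_mem_erase hj)]
        simp only [Function.eval] at hab
        rw [Pi.smul_apply, ha, hupd, hupd, hab, Pi.smul_apply, smul_eq_mul, smul_eq_mul,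
          mul_assoc] }
    1 fun f => by simpa using (norm_tensorLp f).le

/-- A closed subspace containing the products of elements of total sets contains all products. -/
theorem tensorLp_mem_of_dense {κ : ι → Type*} {φ : ∀ i, κ i → Lp ℂ 2 (ν i)}
    (hφ : ∀ i, (Submodule.span ℂ (Set.range (φ i))).topologicalClosure = ⊤)
    {S : Submodule ℂ (Lp ℂ 2 (Measure.pi ν))} (hS : IsClosed (S : Set (Lp ℂ 2 (Measure.pi ν))))
    (h : ∀ k : ∀ i, κ i, tensorLp (fun i => φ i (k i)) ∈ S) (f : ∀ i, Lp ℂ 2 (ν i)) :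
    tensorLp f ∈ S := by
  -- Induction on the set of coordinates in which the factor is arbitrary; the remaining factors are
  -- still taken from the total families.
  classical
  suffices H : ∀ s : Finset ι, ∀ f : ∀ i, Lp ℂ 2 (ν i),
      (∀ i ∉ s, f i ∈ Set.range (φ i)) → tensorLp f ∈ S from
    H Finset.univ f fun i hi => absurd (Finset.mem_univ i) hi
  intro s
  induction s using Finset.induction_on with
  | empty =>
    intro f hf
    choose k hk using fun i => hf i (Finset.notMem_empty i)
    rw [← funext hk]
    exact h k
  | insert i s his ih =>
    intro f hf
    let T := (tensorCLM ν).toContinuousLinearMap f i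
    have hT : ∀ a, T a = tensorLp (Function.update f i a) := fun a => rfl
    have hcl : IsClosed ((S.comap T.toLinearMap : Submodule ℂ _) : Set (Lp ℂ 2 (ν i))) :=
      hS.preimage T.continuous
    -- With the other factors frozen, the admissible vectors in slot `i` form a closed subspace;
    -- containing the total family, it is everything.
    have hle : (Submodule.span ℂ (Set.range (φ i))).topologicalClosure ≤ S.comap T.toLinearMap := by
      refine Submodule.topologicalClosure_minimal _ (Submodule.span_le.2 ?_) hcl
      intro a ha
      change T a ∈ S
      rw [hT]
      refine ih _ fun j hj => ?_
      by_cases hji : j = i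
      · subst hji
        simpa using ha
      · rw [Function.update_of_ne hji]
        exact hf j (by simp [hji, hj])
    rw [hφ i] at hle
    have := hle (Submodule.mem_top (x := f i))
    change T (f i) ∈ S at this
    rwa [hT, Function.update_eq_self] at this

/-- The sets of finite measure span a σ-finite measure. -/
noncomputable def finiteSpanningSetsInFinite {α : Type*} [MeasurableSpace α] (μ : Measure α)
    [SigmaFinite μ] : μ.FiniteSpanningSetsIn {s | MeasurableSet s ∧ μ s < ⊤} where
  set := spanningSets μ
  set_mem k := ⟨measurableSet_spanningSets μ k, measure_spanningSets_lt_top μ k⟩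
  finite := measure_spanningSets_lt_top μ
  spanning := iUnion_spanningSets μ

theorem generateFrom_measurableSet_finite {α : Type*} [m : MeasurableSpace α] (μ : Measure α)
    [SigmaFinite μ] : MeasurableSpace.generateFrom {s | MeasurableSet s ∧ μ s < ⊤} = m := by
  refine le_antisymm (MeasurableSpace.generateFrom_le fun s hs => hs.1) fun s hs => ?_
  rw [← Set.inter_univ s, ← iUnion_spanningSets μ, Set.inter_iUnion]
  refine MeasurableSet.iUnion fun k => MeasurableSpace.measurableSet_generateFrom
    ⟨hs.inter (measurableSet_spanningSets μ k), ?_⟩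
  exact (measure_mono Set.inter_subset_right).trans_lt (measure_spanningSets_lt_top μ k)

/-- The square integrable products of functions of separate variables are total. -/
theorem eq_zero_of_forall_inner_tensorLp_eq_zero (g : Lp ℂ 2 (Measure.pi ν))
    (hg : ∀ f : ∀ i, Lp ℂ 2 (ν i), inner ℂ (tensorLp f) g = 0) : g = 0 := by
  have hpi : ∀ i, IsPiSystem {s : Set (X i) | MeasurableSet s ∧ ν i s < ⊤} := fun i s hs t ht _ =>
    ⟨hs.1.inter ht.1, (measure_mono Set.inter_subset_left).trans_lt hs.2⟩
  refine Lp_eq_zero_of_forall_setIntegral_eq_zero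
    (generateFrom_eq_pi (fun i => generateFrom_measurableSet_finite (ν i))
      fun i => (finiteSpanningSetsInFinite (ν i)).isCountablySpanning).symm
    (IsPiSystem.pi hpi) (Measure.FiniteSpanningSetsIn.pi fun i => finiteSpanningSetsInFinite (ν i))
    g ?_
  rintro _ ⟨s, hs, rfl⟩ hfin
  have hs : ∀ i, MeasurableSet (s i) ∧ ν i (s i) < ⊤ := fun i => hs i (Set.mem_univ i)
  have hm : MeasurableSet (Set.univ.pi s) := MeasurableSet.univ_pi fun i => (hs i).1
  rw [← L2.inner_indicatorConstLp_one (𝕜 := ℂ) hm hfin.ne g,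
    ← hg fun i => indicatorConstLp 2 (hs i).1 (hs i).2.ne 1]
  congr 1
  refine Lp.ext (indicatorConstLp_coeFn.trans (EventuallyEq.symm ?_))
  refine (coeFn_tensorLp _).trans ((ae_eq_fintype_prod fun i => indicatorConstLp_coeFn).trans ?_)
  refine Eventually.of_forall fun x => ?_
  classical
  by_cases hx : x ∈ Set.univ.pi s
  · rw [Set.indicator_of_mem hx]
    exact Finset.prod_eq_one fun i _ => Set.indicator_of_mem (hx i (Set.mem_univ i)) _
  · rw [Set.indicator_of_notMem hx]
    obtain ⟨i, hi⟩ : ∃ i, x i ∉ s i := by simpa using hx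
    exact Finset.prod_eq_zero (Finset.mem_univ i) (Set.indicator_of_notMem hi _)

/-- The products of the elements of Hilbert bases of the factors form a Hilbert basis. -/
theorem exists_hilbertBasis_pi {κ : ι → Type*} (φ : ∀ i, HilbertBasis (κ i) ℂ (Lp ℂ 2 (ν i))) :
    ∃ b : HilbertBasis (∀ i, κ i) ℂ (Lp ℂ 2 (Measure.pi ν)),
      ∀ k, b k = tensorLp fun i => φ i (k i) := by
  classical
  have hon : Orthonormal ℂ fun k : ∀ i, κ i => tensorLp fun i => φ i (k i) := by
    rw [orthonormal_iff_ite]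
    intro k l
    rw [inner_tensorLp]
    simp only [orthonormal_iff_ite.1 (φ _).orthonormal]
    split_ifs with h
    · simp [h]
    · obtain ⟨i, hi⟩ := Function.ne_iff.1 h
      exact Finset.prod_eq_zero (Finset.mem_univ i) (if_neg hi)
  refine ⟨HilbertBasis.mkOfOrthogonalEqBot hon ?_, fun k => by
    rw [HilbertBasis.coe_mkOfOrthogonalEqBot]⟩
  rw [Submodule.eq_bot_iff]
  intro g hg
  refine eq_zero_of_forall_inner_tensorLp_eq_zero g fun f => ?_
  -- Orthogonality to the span extends to its closure, which contains every tensor.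
  refine Submodule.mem_orthogonal _ _ |>.1 (?_ : g ∈ (Submodule.span ℂ
    (Set.range fun k : ∀ i, κ i => tensorLp fun i => φ i (k i))).topologicalClosureᗮ) _ ?_
  · rwa [Submodule.orthogonal_closure]
  · exact tensorLp_mem_of_dense (fun i => (φ i).dense_span)
      (Submodule.isClosed_topologicalClosure _)
      (fun k => Submodule.le_topologicalClosure _ (Submodule.subset_span (Set.mem_range_self k))) f

end TensorProduct

/-! ### Balls in a regular ultrametric space. -/

section BallGeometry

variable {X : Type*} [MetricSpace X]

theorem isBall_closedBall (x : X) {r : ℝ} (hr : 0 ≤ r) : IsBall (Metric.closedBall x r) :=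
  ⟨x, r, hr, rfl⟩

theorem IsBall.nonempty {I : Set X} (hI : IsBall I) : I.Nonempty := by
  obtain ⟨x, r, hr, rfl⟩ := hI
  exact ⟨x, Metric.mem_closedBall_self hr⟩

theorem IsBall.isBounded {I : Set X} (hI : IsBall I) : Bornology.IsBounded I := by
  obtain ⟨x, r, hr, rfl⟩ := hI
  exact Metric.isBounded_closedBall

theorem IsBall.measurableSet [MeasurableSpace X] [BorelSpace X] {I : Set X} (hI : IsBall I) :
    MeasurableSet I := by
  obtain ⟨x, r, hr, rfl⟩ := hI
  exact measurableSet_closedBall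

theorem IsBall.subset_or_subset_or_disjoint (hX : IsRegularUltrametric X) {I J : Set X}
    (hI : IsBall I) (hJ : IsBall J) : I ⊆ J ∨ J ⊆ I ∨ Disjoint I J := by
  have := hX.ultrametric
  obtain ⟨x, r, hr, rfl⟩ := hI
  obtain ⟨y, s, hs, rfl⟩ := hJ
  exact IsUltrametricDist.closedBall_subset_trichotomy x y r s

theorem isPiSystem_isBall (hX : IsRegularUltrametric X) : IsPiSystem {s : Set X | IsBall s} := by
  intro I hI J hJ hIJ
  rcases hI.subset_or_subset_or_disjoint hX hJ with h | h | h
  · rwa [Set.inter_eq_self_of_subset_left h]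
  · rwa [Set.inter_eq_self_of_subset_right h]
  · exact absurd h (Set.not_disjoint_iff_nonempty_inter.2 hIJ)

theorem IsBall.diam_pos_of_ssubset {I J : Set X} (hI : IsBall I) (hJ : IsBall J) (h : J ⊂ I) :
    0 < Metric.diam I := by
  obtain ⟨y, hyI, hyJ⟩ := Set.exists_of_ssubset h
  obtain ⟨x, hx⟩ := hJ.nonempty
  have hxy : x ≠ y := fun e => hyJ (e ▸ hx)
  exact (dist_pos.2 hxy).trans_le (Metric.dist_le_diam_of_mem hI.isBounded (h.1 hx) hyI)

theorem IsMaximalSubball.eq_or_disjoint (hX : IsRegularUltrametric X) {I J J' : Set X}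
    (hJ : IsMaximalSubball J I) (hJ' : IsMaximalSubball J' I) : J = J' ∨ Disjoint J J' := by
  rcases hJ.1.subset_or_subset_or_disjoint hX hJ'.1 with h | h | h
  · exact Or.inl (hJ.2.2 J' hJ'.1 h hJ'.2.1).symm
  · exact Or.inl (hJ'.2.2 J hJ.1 h hJ.2.1)
  · exact Or.inr h

/-- The finite cover of `I` by maximal subballs has a member `M` meeting `J`. Either `J ⊆ M`, or `M
⊆ J ⊂ I` and maximality forces `M = J`. -/
theorem exists_isMaximalSubball (hX : IsRegularUltrametric X) {I J : Set X} (hI : IsBall I)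
    (hJ : IsBall J) (h : J ⊂ I) : ∃ M, IsMaximalSubball M I ∧ J ⊆ M := by
  obtain ⟨F, -, hF, hU⟩ := hX.finite_union I hI (hI.diam_pos_of_ssubset hJ h)
  obtain ⟨x, hx⟩ := hJ.nonempty
  have hxI : x ∈ ⋃₀ F := hU ▸ h.1 hx
  obtain ⟨M, hM, hxM⟩ := hxI
  have hM := hF M hM
  rcases hM.1.subset_or_subset_or_disjoint hX hJ with h' | h' | h'
  · exact ⟨M, hM, (hM.2.2 J hJ h' h).le⟩
  · exact ⟨M, hM, h'⟩
  · exact absurd hx (Set.disjoint_left.1 h' hxM)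

/-- Maximal subballs are pairwise equal or disjoint, so any family of them covering `I` already
contains all of them. -/
theorem finite_isMaximalSubball (hX : IsRegularUltrametric X) {I : Set X} (hI : IsBall I)
    (hd : 0 < Metric.diam I) :
    {J | IsMaximalSubball J I}.Finite ∧ I = ⋃₀ {J | IsMaximalSubball J I} := by
  obtain ⟨F, hfin, hF, hU⟩ := hX.finite_union I hI hd
  have hsub : {J | IsMaximalSubball J I} ⊆ F := by
    intro J hJ
    obtain ⟨x, hx⟩ := IsBall.nonempty hJ.1
    have hxI : x ∈ ⋃₀ F := hU ▸ hJ.2.1.1 hx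
    obtain ⟨M, hM, hxM⟩ := hxI
    rcases IsMaximalSubball.eq_or_disjoint hX hJ (hF M hM) with h | h
    · exact h ▸ hM
    · exact absurd hxM (Set.disjoint_left.1 h hx)
  have : {J | IsMaximalSubball J I} = F := hsub.antisymm fun J hJ => hF J hJ
  rw [this]
  exact ⟨hfin, hU⟩

/-- A proper subball forces two distinct points; conversely a ball of positive diameter is covered
by maximal subballs, each of which is a smaller vertex. -/
theorem not_isMin_iff_diam_pos (hX : IsRegularUltrametric X) (I : BallTree X) :
    ¬ IsMin I ↔ 0 < Metric.diam I.1 := by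
  have hI : IsBall I.1 := I.2.elim And.left And.left
  constructor
  · intro h
    rw [not_isMin_iff] at h
    obtain ⟨J, hJ⟩ := h
    exact hI.diam_pos_of_ssubset (J.2.elim And.left And.left) hJ
  · intro hd hmin
    obtain ⟨x, hx⟩ := hI.nonempty
    rw [(finite_isMaximalSubball hX hI hd).2] at hx
    obtain ⟨J, hJ, -⟩ := hx
    have hJ : IsMaximalSubball J I.1 := hJ
    have hJT : (IsBall J ∧ 0 < Metric.diam J) ∨ (IsBall J ∧ Metric.diam J = 0 ∧
        ∃ I : Set X, IsBall I ∧ 0 < Metric.diam I ∧ IsMaximalSubball J I) := by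
      rcases (Metric.diam_nonneg (s := J)).lt_or_eq with h | h
      · exact Or.inl ⟨hJ.1, h⟩
      · exact Or.inr ⟨hJ.1, h.symm, I.1, hI, hd, hJ⟩
    exact hJ.2.1.2 (hmin (b := ⟨J, hJT⟩) hJ.2.1.1)

/-- A property that is inherited by maximal subballs descends from a ball to each of its subballs,
or at least to a sequence of balls which shrink to the subball. -/
theorem IsBall.descend (hX : IsRegularUltrametric X) {I L : Set X} (hI : IsBall I) (hL : IsBall L)
    (hIL : I ⊆ L) (Q : Set X → Prop) (hQ : Q L)
    (step : ∀ D M, IsBall D → I ⊆ M → IsMaximalSubball M D → Q D → Q M) :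
    Q I ∨ ∃ D : ℕ → Set X, (∀ k, IsBall (D k) ∧ I ⊆ D k ∧ Q (D k)) ∧ Antitone D ∧
      Tendsto (fun k => Metric.diam (D k)) atTop (𝓝 0) := by
  by_cases hQI : Q I
  · exact Or.inl hQI
  right
  -- Since `Q I` fails, no `D` satisfying `Q` equals `I`, so one can always pass to the maximal
  -- subball of `D` containing `I`.
  have next : ∀ D : {D : Set X // IsBall D ∧ I ⊆ D ∧ Q D},
      ∃ D' : {D : Set X // IsBall D ∧ I ⊆ D ∧ Q D}, D'.1 ⊂ D.1 := by
    rintro ⟨D, hD, hID, hQD⟩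
    have hne : I ≠ D := fun e => hQI (e ▸ hQD)
    obtain ⟨M, hM, hIM⟩ := exists_isMaximalSubball hX hD hI (hID.ssubset_of_ne hne)
    exact ⟨⟨M, hM.1, hIM, step D M hD hIM hM hQD⟩, hM.2.1⟩
  choose f hf using next
  let D : ℕ → {D : Set X // IsBall D ∧ I ⊆ D ∧ Q D} := fun k => f^[k] ⟨L, hL, hIL, hQ⟩
  have hD : ∀ k, (D (k + 1)).1 ⊂ (D k).1 := fun k => by
    simp only [D, Function.iterate_succ_apply']
    exact hf _
  exact ⟨fun k => (D k).1, fun k => (D k).2, antitone_nat_of_succ_le fun k => (hD k).1,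
    hX.diam_tendsto_zero _ (fun k => (D k).2.1) hD⟩

theorem IsBall.iInter_eq_of_diam_tendsto_zero {I : Set X} (hI : IsBall I) {D : ℕ → Set X}
    (hD : ∀ k, IsBall (D k)) (hID : ∀ k, I ⊆ D k)
    (h0 : Tendsto (fun k => Metric.diam (D k)) atTop (𝓝 0)) : ⋂ k, D k = I := by
  refine Set.Subset.antisymm (fun y hy => ?_) (Set.subset_iInter hID)
  obtain ⟨x, hx⟩ := hI.nonempty
  have : dist x y ≤ 0 := ge_of_tendsto' h0 fun k =>
    Metric.dist_le_diam_of_mem (hD k).isBounded (hID k hx) (Set.mem_iInter.1 hy k)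
  rwa [← dist_le_zero.1 this]

theorem countable_ballTree (hX : IsRegularUltrametric X) :
    {s : Set X | (IsBall s ∧ 0 < Metric.diam s) ∨ ∃ I : Set X, (IsBall I ∧ 0 < Metric.diam I) ∧
      IsMaximalSubball s I}.Countable := by
  refine hX.countable_balls.union ?_
  refine (hX.countable_balls.biUnion (t := fun I _ => {J | IsMaximalSubball J I})
    fun I hI => (finite_isMaximalSubball hX hI.1 hI.2).1.countable).mono ?_
  rintro s ⟨I, hI, hs⟩
  exact Set.mem_biUnion hI hs

/-- The Borel σ-algebra of a regular ultrametric space is generated by the balls. -/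
theorem generateFrom_isBall [m : MeasurableSpace X] [BorelSpace X] (hX : IsRegularUltrametric X) :
    MeasurableSpace.generateFrom {s : Set X | IsBall s} = m := by
  refine le_antisymm (MeasurableSpace.generateFrom_le fun s hs => IsBall.measurableSet hs) ?_
  rw [BorelSpace.measurable_eq (α := X)]
  refine MeasurableSpace.generateFrom_le fun U (hU : IsOpen U) => ?_
  -- A one-point space has no ball of positive diameter, so the family `T` below would be empty
  -- there.
  rcases subsingleton_or_nontrivial X with hs | hn
  · rcases U.eq_empty_or_nonempty with rfl | ⟨x, hx⟩
    · exact @MeasurableSet.empty _ (_)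
    · refine MeasurableSpace.measurableSet_generateFrom ⟨x, 0, le_rfl, ?_⟩
      ext y
      simp [Subsingleton.elim y x, hx]
  set T : Set (Set X) := {s : Set X | (IsBall s ∧ 0 < Metric.diam s) ∨
    ∃ I : Set X, (IsBall I ∧ 0 < Metric.diam I) ∧ IsMaximalSubball s I} with hTdef
  have hT : U = ⋃₀ {s | s ∈ T ∧ s ⊆ U} := by
    refine Set.Subset.antisymm (fun x hx => ?_) (Set.sUnion_subset fun s hs => hs.2)
    obtain ⟨y, hy⟩ := exists_ne x
    have hL := isBall_closedBall x (dist_nonneg (x := y) (y := x))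
    have hxL : x ∈ Metric.closedBall x (dist y x) := Metric.mem_closedBall_self dist_nonneg
    have hyL : y ∈ Metric.closedBall x (dist y x) := Metric.mem_closedBall.2 le_rfl
    have hLT : Metric.closedBall x (dist y x) ∈ T := Or.inl ⟨hL, (dist_pos.2 hy).trans_le
      (Metric.dist_le_diam_of_mem hL.isBounded hyL hxL)⟩
    have hI : IsBall ({x} : Set X) := ⟨x, 0, le_rfl, by simp⟩
    -- Descent from a ball of positive diameter to `{x}` stays in the countable family `T`: it
    -- either reaches `{x}` or yields members of `T` around `x` of arbitrarily small diameter.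
    rcases hI.descend hX hL (Set.singleton_subset_iff.2 hxL) (· ∈ T) hLT (fun D M hD _ hM _ =>
      Or.inr ⟨D, ⟨hD, hD.diam_pos_of_ssubset hM.1 hM.2.1⟩, hM⟩) with h | ⟨D, hD, -, h0⟩
    · exact ⟨{x}, ⟨h, by simp [hx]⟩, rfl⟩
    · obtain ⟨ε, hε, hεU⟩ := Metric.isOpen_iff.1 hU x hx
      obtain ⟨k, hk⟩ := (h0.eventually (gt_mem_nhds hε)).exists
      have hxD : x ∈ D k := (hD k).2.1 rfl
      refine ⟨D k, ⟨(hD k).2.2, fun z hz => hεU ?_⟩, hxD⟩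
      exact (Metric.dist_le_diam_of_mem (hD k).1.isBounded hz hxD).trans_lt hk
  rw [hT]
  refine @MeasurableSet.sUnion _ (_) _ ((countable_ballTree hX).mono fun s hs => hs.1) ?_
  rintro s ⟨hs, -⟩
  refine MeasurableSpace.measurableSet_generateFrom ?_
  rcases hs with hs | ⟨I, -, hs⟩
  · exact hs.1
  · exact hs.1

end BallGeometry

/-! ### Orthogonality and completeness of the wavelet spaces on one factor. -/

section WaveletSpaces

variable {X : Type*} [MetricSpace X] [MeasurableSpace X] {ν : Measure X}

theorem ballSpace_ae_eq_zero {I : Set X} {f : Lp ℂ 2 ν} (hf : f ∈ ballSpace ν I) :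
    ∀ᵐ x ∂ν, x ∉ I → f x = 0 := by
  induction hf using Submodule.span_induction with
  | mem f hf =>
    obtain ⟨J, hJ, hf⟩ := hf
    filter_upwards [hf] with x hx hxI
    rw [hx, Set.indicator_of_notMem fun h => hxI (hJ.2.1.1 h)]
  | zero =>
    filter_upwards [Lp.coeFn_zero ℂ 2 ν] with x hx _
    rw [hx, Pi.zero_apply]
  | add f g _ _ hf hg =>
    filter_upwards [hf, hg, Lp.coeFn_add f g] with x hf hg hx hxI
    rw [hx, Pi.add_apply, hf hxI, hg hxI, add_zero]
  | smul c f _ hf =>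
    filter_upwards [hf, Lp.coeFn_smul c f] with x hf hx hxI
    rw [hx, Pi.smul_apply, hf hxI, smul_zero]

theorem ballSpace_ae_const (hX : IsRegularUltrametric X) {I M : Set X} (hM : IsMaximalSubball M I)
    {f : Lp ℂ 2 ν} (hf : f ∈ ballSpace ν I) : ∃ c : ℂ, ∀ᵐ x ∂ν, x ∈ M → f x = c := by
  induction hf using Submodule.span_induction with
  | mem f hf =>
    obtain ⟨J, hJ, hf⟩ := hf
    rcases IsMaximalSubball.eq_or_disjoint hX hM hJ with h | h
    · refine ⟨1, ?_⟩
      filter_upwards [hf] with x hx hxM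
      rw [hx, Set.indicator_of_mem (h ▸ hxM)]
    · refine ⟨0, ?_⟩
      filter_upwards [hf] with x hx hxM
      rw [hx, Set.indicator_of_notMem (Set.disjoint_left.1 h hxM)]
  | zero =>
    refine ⟨0, ?_⟩
    filter_upwards [Lp.coeFn_zero ℂ 2 ν] with x hx _
    rw [hx, Pi.zero_apply]
  | add f g _ _ hf hg =>
    obtain ⟨c, hf⟩ := hf
    obtain ⟨d, hg⟩ := hg
    refine ⟨c + d, ?_⟩
    filter_upwards [hf, hg, Lp.coeFn_add f g] with x hf hg hx hxM
    rw [hx, Pi.add_apply, hf hxM, hg hxM]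
  | smul a f _ hf =>
    obtain ⟨c, hf⟩ := hf
    refine ⟨a • c, ?_⟩
    filter_upwards [hf, Lp.coeFn_smul a f] with x hf hx hxM
    rw [hx, Pi.smul_apply, hf hxM]

/-- `I` lies in one maximal subball of `L`, where `g` is a.e. constant; the inner product is then a
multiple of the mean of `f`. -/
theorem inner_eq_zero_of_ssubset (hX : IsRegularUltrametric X) {I L : Set X} (hI : IsBall I)
    (hL : IsBall L) (hIL : I ⊂ L) {f g : Lp ℂ 2 ν} (hf : f ∈ waveletSpace ν I)
    (hg : g ∈ waveletSpace ν L) : inner ℂ g f = 0 := by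
  obtain ⟨M, hM, hIM⟩ := exists_isMaximalSubball hX hL hI hIL
  obtain ⟨c, hc⟩ := ballSpace_ae_const hX hM hg.1
  have : ∫ x, inner ℂ (g x) (f x) ∂ν = ∫ x, inner ℂ c (f x) ∂ν := by
    refine integral_congr_ae ?_
    filter_upwards [hc, ballSpace_ae_eq_zero hf.1] with x hc hf0
    by_cases hx : x ∈ I
    · rw [hc (hIM hx)]
    · rw [hf0 hx, inner_zero_right, inner_zero_right]
  rw [L2.inner_def, this, integral_inner hf.2.1, hf.2.2, inner_zero_right]

/-- The spaces of wavelets of different balls are orthogonal. -/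
theorem inner_waveletSpace_eq_zero (hX : IsRegularUltrametric X) {I L : Set X} (hI : IsBall I)
    (hL : IsBall L) (hIL : I ≠ L) {f g : Lp ℂ 2 ν} (hf : f ∈ waveletSpace ν I)
    (hg : g ∈ waveletSpace ν L) : inner ℂ f g = 0 := by
  rcases hI.subset_or_subset_or_disjoint hX hL with h | h | h
  · exact inner_eq_zero_symm.1 (inner_eq_zero_of_ssubset hX hI hL (h.ssubset_of_ne hIL) hf hg)
  · exact inner_eq_zero_of_ssubset hX hL hI (h.ssubset_of_ne hIL.symm) hg hf
  · rw [L2.inner_def]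
    refine integral_eq_zero_of_ae ?_
    filter_upwards [ballSpace_ae_eq_zero hf.1, ballSpace_ae_eq_zero hg.1] with x hf hg
    by_cases hx : x ∈ I
    · rw [hg (Set.disjoint_left.1 h hx), inner_zero_right, Pi.zero_apply]
    · rw [hf hx, inner_zero_left, Pi.zero_apply]

theorem nonempty_finiteSpanningSetsIn_isBall (hfin : ∀ s : Set X, IsBall s → ν s < ⊤)
    (hpos : 0 < ν Set.univ) :
    Nonempty (ν.FiniteSpanningSetsIn {s | IsBall s}) := by
  obtain ⟨x⟩ : Nonempty X := by
    by_contra h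
    rw [not_nonempty_iff] at h
    simp [Measure.eq_zero_of_isEmpty ν] at hpos
  exact ⟨{
    set := fun k : ℕ => Metric.closedBall x k
    set_mem := fun k => isBall_closedBall x k.cast_nonneg
    finite := fun k => hfin _ (isBall_closedBall x k.cast_nonneg)
    spanning := Metric.iUnion_closedBall_nat x }⟩

theorem sigmaFinite_of_isBall (hfin : ∀ s : Set X, IsBall s → ν s < ⊤)
    (hpos : 0 < ν Set.univ) : SigmaFinite ν :=
  (nonempty_finiteSpanningSetsIn_isBall hfin hpos).some.sigmaFinite

variable [BorelSpace X]

/-- Distinct maximal subballs are disjoint, so the indicator of the union is the sum of their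
indicators. Allowing any finite subfamily makes the induction possible. -/
theorem indicatorConstLp_sUnion_mem_ballSpace (hX : IsRegularUltrametric X) {I : Set X}
    (hνI : ν I ≠ ⊤) (F : Finset (Set X)) (hF : ∀ J ∈ F, IsMaximalSubball J I)
    (hm : MeasurableSet (⋃₀ (F : Set (Set X)))) (hfin : ν (⋃₀ (F : Set (Set X))) ≠ ⊤) :
    indicatorConstLp 2 hm hfin (1 : ℂ) ∈ ballSpace ν I := by
  classical
  induction F using Finset.induction_on with
  | empty =>
    convert Submodule.zero_mem (ballSpace ν I)
    refine Lp.ext (indicatorConstLp_coeFn.trans (EventuallyEq.trans ?_ (Lp.coeFn_zero ℂ 2 ν).symm))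
    simp
    rfl
  | insert J F hJF ih =>
    have hJ := hF J (Finset.mem_insert_self J F)
    have hF' : ∀ J ∈ F, IsMaximalSubball J I := fun J h => hF J (Finset.mem_insert_of_mem h)
    have hJm : MeasurableSet J := IsBall.measurableSet hJ.1
    have hFm : MeasurableSet (⋃₀ (F : Set (Set X))) :=
      MeasurableSet.sUnion F.countable_toSet fun J h => IsBall.measurableSet (hF' J h).1
    have hJfin : ν J ≠ ⊤ := measure_ne_top_of_subset hJ.2.1.1 hνI
    have hFfin : ν (⋃₀ (F : Set (Set X))) ≠ ⊤ :=
      measure_ne_top_of_subset (Set.sUnion_subset fun J h => (hF' J h).2.1.1) hνI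
    have hdis : Disjoint J (⋃₀ (F : Set (Set X))) := Set.disjoint_sUnion_right.2 fun L hL =>
      (IsMaximalSubball.eq_or_disjoint hX hJ (hF' L hL)).resolve_left fun e => hJF (e ▸ hL)
    have hsum := indicatorConstLp_disjoint_union (p := 2) hJm hFm hJfin hFfin hdis (1 : ℂ)
    have hmem : indicatorConstLp 2 (hJm.union hFm) (by finiteness) (1 : ℂ) ∈ ballSpace ν I := by
      rw [hsum]
      exact Submodule.add_mem _ (Submodule.subset_span ⟨J, hJ, indicatorConstLp_coeFn⟩)
        (ih hF' hFm hFfin)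
    convert hmem using 2
    simp

theorem indicatorConstLp_mem_ballSpace (hX : IsRegularUltrametric X)
    (hfin : ∀ s : Set X, IsBall s → ν s < ⊤) {I : Set X} (hI : IsBall I) (hd : 0 < Metric.diam I) :
    indicatorConstLp 2 hI.measurableSet (hfin I hI).ne (1 : ℂ) ∈ ballSpace ν I := by
  obtain ⟨hF, hU⟩ := finite_isMaximalSubball hX hI hd
  have hU' : ⋃₀ (hF.toFinset : Set (Set X)) = I := by rw [hF.coe_toFinset, ← hU]
  have := indicatorConstLp_sUnion_mem_ballSpace (ν := ν) hX (hfin I hI).ne hF.toFinset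
    (fun J hJ => by simpa using hJ) (hU'.symm ▸ hI.measurableSet) (hU'.symm ▸ (hfin I hI).ne)
  convert this using 2
  exact hU'.symm

/-- A function orthogonal to the wavelets of a ball has the same mean on the ball as on each of
its maximal subballs. -/
theorem setIntegral_mul_of_isMaximalSubball (hX : IsRegularUltrametric X)
    (hfin : ∀ s : Set X, IsBall s → ν s < ⊤) {I M : Set X} (hI : IsBall I)
    (hM : IsMaximalSubball M I) {g : Lp ℂ 2 ν} (hg : ∀ f ∈ waveletSpace ν I, inner ℂ f g = 0) :
    (∫ x in M, g x ∂ν) * ν.real I = (∫ x in I, g x ∂ν) * ν.real M := by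
  have hMb : IsBall M := hM.1
  set eM := indicatorConstLp 2 hMb.measurableSet (hfin M hMb).ne (1 : ℂ) with heM
  set eI := indicatorConstLp 2 hI.measurableSet (hfin I hI).ne (1 : ℂ) with heI
  have hiM : Integrable eM ν := integrable_indicatorConstLp _ _ _
  have hiI : Integrable eI ν := integrable_indicatorConstLp _ _ _
  have hcoe : ⇑((ν.real I : ℂ) • eM - (ν.real M : ℂ) • eI) =ᵐ[ν]
      (ν.real I : ℂ) • ⇑eM - (ν.real M : ℂ) • ⇑eI :=
    (Lp.coeFn_sub _ _).trans ((Lp.coeFn_smul _ _).sub (Lp.coeFn_smul _ _))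
  -- The test vector `ν(I) 1_M - ν(M) 1_I` has mean zero; pairing it with `g` is exactly the claim.
  have hmem : (ν.real I : ℂ) • eM - (ν.real M : ℂ) • eI ∈ waveletSpace ν I := by
    refine ⟨Submodule.sub_mem _ (Submodule.smul_mem _ _ (Submodule.subset_span
      ⟨M, hM, indicatorConstLp_coeFn⟩)) (Submodule.smul_mem _ _
      (indicatorConstLp_mem_ballSpace hX hfin hI (hI.diam_pos_of_ssubset hMb hM.2.1))), ?_, ?_⟩
    · exact ((hiM.smul _).sub (hiI.smul _)).congr hcoe.symm
    · rw [integral_congr_ae hcoe, integral_sub' (hiM.smul _) (hiI.smul _)]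
      simp only [Pi.smul_apply]
      rw [integral_smul, integral_smul, heM, heI, integral_indicatorConstLp,
        integral_indicatorConstLp]
      simp [mul_comm]
  have h := hg _ hmem
  rw [inner_sub_left, inner_smul_left, inner_smul_left, heM, heI, L2.inner_indicatorConstLp_one,
    L2.inner_indicatorConstLp_one, Complex.conj_ofReal, Complex.conj_ofReal, sub_eq_zero] at h
  rw [mul_comm, h, mul_comm]

/-- A function orthogonal to all wavelets has the same mean on all nested balls. -/
theorem setIntegral_mul_of_subset (hX : IsRegularUltrametric X)
    (hfin : ∀ s : Set X, IsBall s → ν s < ⊤) {I L : Set X} (hI : IsBall I) (hL : IsBall L)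
    (hIL : I ⊆ L) {g : Lp ℂ 2 ν}
    (hg : ∀ D, IsBall D → 0 < Metric.diam D → ∀ f ∈ waveletSpace ν D, inner ℂ f g = 0) :
    (∫ x in I, g x ∂ν) * ν.real L = (∫ x in L, g x ∂ν) * ν.real I := by
  have step : ∀ D M, IsBall D → I ⊆ M → IsMaximalSubball M D →
      (∫ x in D, g x ∂ν) * ν.real L = (∫ x in L, g x ∂ν) * ν.real D →
      (∫ x in M, g x ∂ν) * ν.real L = (∫ x in L, g x ∂ν) * ν.real M := by
    intro D M hD hIM hM hQ
    have hs := setIntegral_mul_of_isMaximalSubball hX hfin hD hM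
      (hg D hD (hD.diam_pos_of_ssubset hM.1 hM.2.1))
    -- Chaining the two proportions requires cancelling `ν(D)`; if it vanishes, `M` is null as well
    -- and both sides are zero.
    by_cases h0 : ν.real D = 0
    · have hD0 : ν D = 0 := (measureReal_eq_zero_iff (hfin D hD).ne).1 h0
      have hM0 : ν M = 0 := measure_mono_null hM.2.1.1 hD0
      rw [setIntegral_measure_zero _ hM0, measureReal_def ν M, hM0]
      simp
    · have h0 : (ν.real D : ℂ) ≠ 0 := by exact_mod_cast h0
      refine mul_right_cancel₀ h0 ?_
      linear_combination (ν.real L : ℂ) * hs + (ν.real M : ℂ) * hQ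
  rcases hI.descend hX hL hIL
    (fun D => (∫ x in D, g x ∂ν) * ν.real L = (∫ x in L, g x ∂ν) * ν.real D) rfl step with
    h | ⟨D, hD, hanti, h0⟩
  · exact h
  -- When `I` is not reached in finitely many steps, the identity passes to the limit along balls
  -- decreasing to `I`.
  · have hInt : ⋂ k, D k = I :=
      hI.iInter_eq_of_diam_tendsto_zero (fun k => (hD k).1) (fun k => (hD k).2.1) h0
    have h1 := tendsto_setIntegral_of_antitone (μ := ν) (f := g) (fun k => (hD k).1.measurableSet)
      hanti ⟨0, integrableOn_Lp_of_measure_ne_top g one_le_two (hfin _ (hD 0).1).ne⟩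
    have h2 := tendsto_measure_iInter_atTop (μ := ν)
      (fun k => (hD k).1.measurableSet.nullMeasurableSet) hanti ⟨0, (hfin _ (hD 0).1).ne⟩
    rw [hInt] at h1 h2
    have h3 : Tendsto (fun k => ((ν.real (D k) : ℝ) : ℂ)) atTop (𝓝 (ν.real I : ℂ)) :=
      (Complex.continuous_ofReal.tendsto _).comp
        ((ENNReal.tendsto_toReal (hfin I hI).ne).comp h2)
    refine tendsto_nhds_unique (h1.mul_const _) ?_
    simp only [(hD _).2.2]
    exact h3.const_mul _

/-- Cauchy–Schwarz against the indicator of `L`. -/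
theorem norm_setIntegral_le (hfin : ∀ s : Set X, IsBall s → ν s < ⊤)
    {L : Set X} (hL : IsBall L) (g : Lp ℂ 2 ν) :
    ‖∫ x in L, g x ∂ν‖ ≤ √(ν.real L) * ‖g‖ := by
  rw [← L2.inner_indicatorConstLp_one (𝕜 := ℂ) hL.measurableSet (hfin L hL).ne g]
  refine (norm_inner_le_norm _ _).trans (mul_le_mul_of_nonneg_right ?_ (norm_nonneg _))
  refine norm_indicatorConstLp_le.trans_eq ?_
  rw [norm_one, one_mul, Real.sqrt_eq_rpow]
  simp

/-- A function orthogonal to all wavelets, and to the constants if the measure is finite,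
integrates to zero over balls. -/
theorem setIntegral_eq_zero_of_isBall (hX : IsRegularUltrametric X)
    (hfin : ∀ s : Set X, IsBall s → ν s < ⊤) (hpos : 0 < ν Set.univ) {g : Lp ℂ 2 ν}
    (hg : ∀ D, IsBall D → 0 < Metric.diam D → ∀ f ∈ waveletSpace ν D, inner ℂ f g = 0)
    (hconst : ν Set.univ < ⊤ → ∫ x, g x ∂ν = 0) {I : Set X} (hI : IsBall I) :
    ∫ x in I, g x ∂ν = 0 := by
  obtain ⟨x, r, hr, rfl⟩ := id hI
  set I := Metric.closedBall x r
  set B : ℕ → Set X := fun k => Metric.closedBall x k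
  have hB : ∀ k, IsBall (B k) := fun k => isBall_closedBall x k.cast_nonneg
  have hU : ⋃ k, B k = Set.univ := Metric.iUnion_closedBall_nat x
  have hmono : Monotone B := fun _ _ h =>
    Metric.closedBall_subset_closedBall (by exact_mod_cast h)
  have hsub : ∀ᶠ k in atTop, I ⊆ B k := by
    filter_upwards [eventually_ge_atTop ⌈r⌉₊] with k hk
    exact Metric.closedBall_subset_closedBall ((Nat.le_ceil r).trans (by exact_mod_cast hk))
  have hkey : ∀ᶠ k in atTop,
      (∫ x in I, g x ∂ν) * ν.real (B k) = (∫ x in B k, g x ∂ν) * ν.real I := by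
    filter_upwards [hsub] with k hk
    exact setIntegral_mul_of_subset hX hfin hI (hB k) hk hg
  have hν := tendsto_measure_iUnion_atTop (μ := ν) hmono
  rw [hU] at hν
  by_cases htop : ν Set.univ < ⊤
  · have : IsFiniteMeasure ν := ⟨htop⟩
    have hgi : Integrable g ν := (Lp.memLp g).integrable one_le_two
    have h1 := tendsto_setIntegral_of_monotone (μ := ν) (f := g) (fun k => (hB k).measurableSet)
      hmono hgi.integrableOn
    rw [hU, setIntegral_univ, hconst htop] at h1
    have h3 : Tendsto (fun k => ((ν.real (B k) : ℝ) : ℂ)) atTop (𝓝 (ν.real Set.univ : ℂ)) :=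
      (Complex.continuous_ofReal.tendsto _).comp ((ENNReal.tendsto_toReal htop.ne).comp hν)
    have h4 := tendsto_nhds_unique_of_eventuallyEq (h3.const_mul (∫ x in I, g x ∂ν))
      (h1.mul_const _) hkey
    rw [zero_mul, mul_eq_zero] at h4
    refine h4.resolve_right ?_
    have : ν.real Set.univ ≠ 0 := (ENNReal.toReal_pos hpos.ne' htop.ne).ne'
    exact_mod_cast this
  · rw [not_lt_top_iff] at htop
    rw [htop] at hν
    by_contra hne
    have hG : 0 < ‖∫ x in I, g x ∂ν‖ := norm_pos_iff.2 hne
    -- A nonzero integral over `I` would give `√(ν(B k)) ≤ C` by equality of means and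
    -- Cauchy–Schwarz, contradicting `ν(B k) → ∞`.
    set C : ℝ := ‖g‖ * ν.real I / ‖∫ x in I, g x ∂ν‖ with hC
    have hbd : ∀ᶠ k in atTop, ν.real (B k) ≤ C ^ 2 := by
      filter_upwards [hkey] with k hk
      have h1 := congrArg norm hk
      rw [norm_mul, norm_mul, Complex.norm_real, Complex.norm_real,
        Real.norm_of_nonneg measureReal_nonneg, Real.norm_of_nonneg measureReal_nonneg] at h1
      have h2 := mul_le_mul_of_nonneg_right (norm_setIntegral_le hfin (hB k) g)
        (measureReal_nonneg (μ := ν) (s := I))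
      rw [← h1] at h2
      have hs := Real.mul_self_sqrt (measureReal_nonneg (μ := ν) (s := B k))
      rcases (Real.sqrt_nonneg (ν.real (B k))).eq_or_lt with h0 | h0
      · rw [← hs, ← h0, mul_zero]
        positivity
      · have h3 : √(ν.real (B k)) ≤ C := by
          rw [hC, le_div_iff₀ hG]
          refine le_of_mul_le_mul_left ?_ h0
          calc √(ν.real (B k)) * (√(ν.real (B k)) * ‖∫ x in I, g x ∂ν‖)
              = ‖∫ x in I, g x ∂ν‖ * ν.real (B k) := by rw [← mul_assoc, hs, mul_comm]
            _ ≤ √(ν.real (B k)) * (‖g‖ * ν.real I) := by rw [← mul_assoc]; exact h2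
        rw [← Real.sq_sqrt (measureReal_nonneg (μ := ν) (s := B k))]
        gcongr
    have hbig := hν.eventually (lt_mem_nhds (ENNReal.ofReal_lt_top (r := C ^ 2)))
    obtain ⟨k, hk1, hk2⟩ := (hbd.and hbig).exists
    refine absurd hk2 (not_lt.2 ?_)
    rw [Function.comp_apply, ← ENNReal.ofReal_toReal (hfin _ (hB k)).ne]
    exact ENNReal.ofReal_le_ofReal hk1

/-- A function orthogonal to all wavelets, and to the constants if the measure is finite, is
zero. -/
theorem eq_zero_of_forall_inner_waveletSpace_eq_zero (hX : IsRegularUltrametric X)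
    (hfin : ∀ s : Set X, IsBall s → ν s < ⊤) (hpos : 0 < ν Set.univ) {g : Lp ℂ 2 ν}
    (hg : ∀ D, IsBall D → 0 < Metric.diam D → ∀ f ∈ waveletSpace ν D, inner ℂ f g = 0)
    (hconst : ν Set.univ < ⊤ → ∫ x, g x ∂ν = 0) : g = 0 :=
  Lp_eq_zero_of_forall_setIntegral_eq_zero (generateFrom_isBall hX).symm (isPiSystem_isBall hX)
    (nonempty_finiteSpanningSetsIn_isBall hfin hpos).some g fun _ hs _ =>
    setIntegral_eq_zero_of_isBall hX hfin hpos hg hconst hs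

end WaveletSpaces

/-! ### Hilbert bases of wavelets on one factor. -/

section WaveletBasis

variable {X : Type u} [MetricSpace X]

theorem NonminimalBall.isBall (I : NonminimalBall X) : IsBall I.1.1 :=
  I.1.2.elim And.left And.left

theorem exists_nonminimalBall (hX : IsRegularUltrametric X) {I : Set X} (hI : IsBall I)
    (hd : 0 < Metric.diam I) : ∃ B : NonminimalBall X, B.1.1 = I :=
  ⟨⟨⟨I, Or.inl ⟨hI, hd⟩⟩, (not_isMin_iff_diam_pos hX _).2 hd⟩, rfl⟩

variable [MeasurableSpace X] {ν : Measure X}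

variable {J : NonminimalBall X → Type w} [∀ I, Fintype (J I)]
  (ψ : ∀ I : NonminimalBall X, OrthonormalBasis (J I) ℂ (waveletSpace ν I.1.1))

/-- Expand `f` in the basis `ψ I`. Completeness thus need only be tested on basis wavelets, whatever
bases were chosen. -/
theorem inner_eq_zero_of_mem_waveletSpace (I : NonminimalBall X) {g : Lp ℂ 2 ν}
    (hg : ∀ j, inner ℂ (ψ I j : Lp ℂ 2 ν) g = 0) {f : Lp ℂ 2 ν}
    (hf : f ∈ waveletSpace ν I.1.1) : inner ℂ f g = 0 := by
  have h := congrArg Subtype.val ((ψ I).sum_repr ⟨f, hf⟩)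
  rw [← show _ = f from h]
  simp [sum_inner, inner_smul_left, hg]

theorem inner_wavelet_wavelet (hX : IsRegularUltrametric X) {I L : NonminimalBall X} (i : J I)
    (l : J L) (h : (⟨I, i⟩ : Σ I, J I) ≠ ⟨L, l⟩) :
    inner ℂ (ψ I i : Lp ℂ 2 ν) (ψ L l : Lp ℂ 2 ν) = 0 := by
  by_cases hIL : I = L
  · subst hIL
    have hil : i ≠ l := fun e => h (e ▸ rfl)
    exact (ψ I).orthonormal.2 hil
  · exact inner_waveletSpace_eq_zero hX I.isBall L.isBall
      (fun e => hIL (Subtype.ext (Subtype.ext e))) (ψ I i).2 (ψ L l).2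

theorem inner_indicatorConstLp_univ_wavelet (hν : ν Set.univ ≠ ⊤) (c : ℂ) {I : NonminimalBall X}
    (i : J I) :
    inner ℂ (indicatorConstLp 2 MeasurableSet.univ hν c) (ψ I i : Lp ℂ 2 ν) = 0 := by
  rw [L2.inner_indicatorConstLp_eq_inner_setIntegral, setIntegral_univ, (ψ I i).2.2.2,
    inner_zero_right]

/-- The augmented wavelets as elements of `L²`. -/
noncomputable def augmentedWaveletLp :
    (I : AugmentedTree ν) → (h : AugmentedTree.IsGeneric I) → augmentedIndex J I h → Lp ℂ 2 ν
  | ⟨none, h⟩, _, _ => indicatorConstLp 2 MeasurableSet.univ (h rfl).ne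
      (((ν Set.univ).toReal ^ (-(1 / 2) : ℝ) : ℝ) : ℂ)
  | ⟨some B, _⟩, h, j => (ψ ⟨B, h B rfl⟩ j : Lp ℂ 2 ν)

theorem coeFn_augmentedWaveletLp (I : AugmentedTree ν) (h : AugmentedTree.IsGeneric I)
    (j : augmentedIndex J I h) :
    ⇑(augmentedWaveletLp ψ I h j) =ᵐ[ν] augmentedWavelet ψ I h j := by
  rcases I with ⟨_ | B, hI⟩
  · refine (indicatorConstLp_coeFn (hs := MeasurableSet.univ) (hμs := (hI rfl).ne)).trans ?_
    rw [Set.indicator_univ]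
    rfl
  · rfl

variable [BorelSpace X]

/-- On a space of infinite measure the wavelets form a Hilbert basis. -/
theorem exists_hilbertBasis_wavelet (hX : IsRegularUltrametric X)
    (hfin : ∀ s : Set X, IsBall s → ν s < ⊤) (hν : ν Set.univ = ⊤) :
    ∃ b : HilbertBasis (Σ I, J I) ℂ (Lp ℂ 2 ν), ∀ p, b p = (ψ p.1 p.2 : Lp ℂ 2 ν) := by
  have hon : Orthonormal ℂ fun p : Σ I, J I => (ψ p.1 p.2 : Lp ℂ 2 ν) :=
    ⟨fun p => (ψ p.1).orthonormal.1 p.2, fun p q h => inner_wavelet_wavelet ψ hX p.2 q.2 h⟩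
  refine ⟨HilbertBasis.mkOfOrthogonalEqBot hon ?_, fun p => by
    rw [HilbertBasis.coe_mkOfOrthogonalEqBot]⟩
  refine (Submodule.eq_bot_iff _).2 fun g hg => ?_
  refine eq_zero_of_forall_inner_waveletSpace_eq_zero hX hfin (by simp [hν]) ?_ (by simp [hν])
  intro D hD hd f hf
  obtain ⟨I, rfl⟩ := exists_nonminimalBall hX hD hd
  exact inner_eq_zero_of_mem_waveletSpace ψ I (fun j => (Submodule.mem_orthogonal _ _).1 hg _
    (Submodule.subset_span ⟨⟨I, j⟩, rfl⟩)) hf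

/-- The augmented wavelets form a Hilbert basis. -/
theorem exists_hilbertBasis_augmentedWavelet (hX : IsRegularUltrametric X)
    (hfin : ∀ s : Set X, IsBall s → ν s < ⊤) (hpos : 0 < ν Set.univ) :
    ∃ b : HilbertBasis (Σ I : {I : AugmentedTree ν // AugmentedTree.IsGeneric I},
        augmentedIndex J I.1 I.2) ℂ (Lp ℂ 2 ν),
      ∀ p, ⇑(b p) =ᵐ[ν] augmentedWavelet ψ p.1.1 p.1.2 p.2 := by
  have hon : Orthonormal ℂ fun p : Σ I : {I : AugmentedTree ν // AugmentedTree.IsGeneric I},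
      augmentedIndex J I.1 I.2 => augmentedWaveletLp ψ p.1.1 p.1.2 p.2 := by
    constructor
    · rintro ⟨⟨⟨_ | B, hI⟩, hgen⟩, j⟩
      · have hν : 0 < (ν Set.univ).toReal := ENNReal.toReal_pos hpos.ne' (hI rfl).ne
        refine (norm_indicatorConstLp (hs := MeasurableSet.univ) (hμs := (hI rfl).ne) two_ne_zero
          ENNReal.ofNat_ne_top).trans ?_
        -- The norm is `A ^ (-1/2) * A ^ (1/2)` with `A = ν(X)`, and the exponents add up to zero.
        rw [Complex.norm_real, Real.norm_of_nonneg (Real.rpow_nonneg hν.le _), measureReal_def,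
          ← Real.rpow_add hν]
        simp
      · exact (ψ ⟨B, hgen B rfl⟩).orthonormal.1 j
    · rintro ⟨⟨⟨_ | B, hI⟩, hgen⟩, j⟩ ⟨⟨⟨_ | B', hI'⟩, hgen'⟩, j'⟩ hne
      · exact absurd rfl hne
      · exact inner_indicatorConstLp_univ_wavelet ψ (hI rfl).ne _ _
      · exact inner_eq_zero_symm.1 (inner_indicatorConstLp_univ_wavelet ψ (hI' rfl).ne _ _)
      · refine inner_wavelet_wavelet ψ hX j j' fun e => hne ?_
        have hB : B = B' := congrArg (fun p : Σ I, J I => p.1.1) e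
        subst hB
        have hj := eq_of_heq (Sigma.mk.inj e).2
        subst hj
        rfl
  refine ⟨HilbertBasis.mkOfOrthogonalEqBot hon ?_, fun p => by
    rw [HilbertBasis.coe_mkOfOrthogonalEqBot]
    exact coeFn_augmentedWaveletLp ψ _ _ _⟩
  refine (Submodule.eq_bot_iff _).2 fun g hg => ?_
  have hg : ∀ I h j, inner ℂ (augmentedWaveletLp ψ I h j) g = 0 := fun I h j =>
    (Submodule.mem_orthogonal _ _).1 hg _ (Submodule.subset_span ⟨⟨⟨I, h⟩, j⟩, rfl⟩)
  refine eq_zero_of_forall_inner_waveletSpace_eq_zero hX hfin hpos ?_ ?_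
  · intro D hD hd f hf
    obtain ⟨I, rfl⟩ := exists_nonminimalBall hX hD hd
    refine inner_eq_zero_of_mem_waveletSpace ψ I (fun j => ?_) hf
    exact hg ⟨some I.1, fun h => by cases h⟩ (fun B hB => by cases hB; exact I.2) j
  · intro htop
    -- Orthogonality to the wavelet at the added vertex says that a nonzero multiple of `∫ g`
    -- vanishes.
    have h : inner ℂ (indicatorConstLp 2 MeasurableSet.univ htop.ne
        (((ν Set.univ).toReal ^ (-(1 / 2) : ℝ) : ℝ) : ℂ)) g = 0 :=
      hg ⟨none, fun _ => htop⟩ (fun B hB => by cases hB) PUnit.unit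
    rw [L2.inner_indicatorConstLp_eq_inner_setIntegral, setIntegral_univ, RCLike.inner_apply,
      mul_eq_zero] at h
    refine h.resolve_right ?_
    have : (ν Set.univ).toReal ^ (-(1 / 2) : ℝ) ≠ 0 :=
      (Real.rpow_pos_of_pos (ENNReal.toReal_pos hpos.ne' htop.ne) _).ne'
    simpa using this

end WaveletBasis

/-- Transport of a Hilbert basis along an equivalence of index types. -/
theorem exists_hilbertBasis_reindex {ι κ E : Type*} [NormedAddCommGroup E] [InnerProductSpace ℂ E]
    [CompleteSpace E] (b : HilbertBasis κ ℂ E) (e : ι ≃ κ) :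
    ∃ b' : HilbertBasis ι ℂ E, ∀ i, b' i = b (e i) := by
  refine ⟨HilbertBasis.mk (b.orthonormal.comp e e.injective) ?_, fun i => by
    rw [HilbertBasis.coe_mk, Function.comp_apply]⟩
  rw [Set.range_comp, e.range_eq_univ, Set.image_univ, b.dense_span]

/-! ### Multi-indices on the product as families of indices on the factors. -/

section Product

variable {n : ℕ} {X : Fin n → Type u} [∀ i, MetricSpace (X i)] [∀ i, MeasurableSpace (X i)]

/-- A wavelet index on the product is a family of wavelet indices on the factors. -/
def waveletIndexEquiv (J : ∀ i, NonminimalBall (X i) → Type w) :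
    WaveletIndex J ≃ ∀ i, Σ I : NonminimalBall (X i), J i I where
  toFun p i := ⟨⟨p.1.1 i, p.1.2 i⟩, p.2 i⟩
  invFun q := ⟨⟨fun i => (q i).1.1, fun i => (q i).1.2⟩, fun i => (q i).2⟩
  left_inv _ := rfl
  right_inv _ := rfl

/-- An augmented wavelet index on the product is a family of such indices on the factors. -/
def augmentedWaveletIndexEquiv (ν : ∀ i, Measure (X i))
    (J : ∀ i, NonminimalBall (X i) → Type w) :
    AugmentedWaveletIndex ν J ≃ ∀ i,
      Σ I : {I : AugmentedTree (ν i) // AugmentedTree.IsGeneric I}, augmentedIndex (J i) I.1 I.2 where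
  toFun p i := ⟨⟨p.1.1 i, p.1.2 i⟩, p.2 i⟩
  invFun q := ⟨⟨fun i => (q i).1.1, fun i => (q i).1.2⟩, fun i => (q i).2⟩
  left_inv _ := rfl
  right_inv _ := rfl

end Product

end UltrametricWavelets

open UltrametricWavelets
theorem mainTheorem3 {n : ℕ} {X : Fin n → Type u} [∀ i, MetricSpace (X i)]
    [∀ i, MeasurableSpace (X i)] [∀ i, BorelSpace (X i)]
    (hX : ∀ i, IsRegularUltrametric (X i))
    (ν : ∀ i, Measure (X i))
    (hfin : ∀ i, ∀ s : Set (X i), IsBall s → ν i s < ⊤)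
    (hpos : ∀ i, 0 < ν i Set.univ)
    {J : ∀ i, NonminimalBall (X i) → Type w} [∀ i I, Fintype (J i I)]
    (ψ : ∀ i (I : NonminimalBall (X i)),
      OrthonormalBasis (J i I) ℂ (waveletSpace (ν i) I.1.1)) :
    ((∀ i, ν i Set.univ = ⊤) →
      ∃ b : HilbertBasis (WaveletIndex J) ℂ (Lp ℂ 2 (Measure.pi ν)),
        ∀ p : WaveletIndex J, ⇑(b p) =ᵐ[Measure.pi ν] multiWavelet ψ p) ∧
    ((∃ i, ν i Set.univ < ⊤) →
      ∃ b : HilbertBasis (AugmentedWaveletIndex ν J) ℂ (Lp ℂ 2 (Measure.pi ν)),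
        ∀ p : AugmentedWaveletIndex ν J, ⇑(b p) =ᵐ[Measure.pi ν] augmentedMultiWavelet ψ p) := by
  have hσ : ∀ i, SigmaFinite (ν i) := fun i => sigmaFinite_of_isBall (hfin i) (hpos i)
  constructor
  · intro htop
    choose φ hφ using fun i => exists_hilbertBasis_wavelet (ψ i) (hX i) (hfin i) (htop i)
    obtain ⟨b, hb⟩ := exists_hilbertBasis_pi φ
    obtain ⟨b', hb'⟩ := exists_hilbertBasis_reindex b (waveletIndexEquiv J)
    refine ⟨b', fun p => ?_⟩
    rw [hb', hb]
    simp only [hφ]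
    exact coeFn_tensorLp _
  · intro _
    choose φ hφ using fun i => exists_hilbertBasis_augmentedWavelet (ψ i) (hX i) (hfin i) (hpos i)
    obtain ⟨b, hb⟩ := exists_hilbertBasis_pi φ
    obtain ⟨b', hb'⟩ := exists_hilbertBasis_reindex b (augmentedWaveletIndexEquiv ν J)
    refine ⟨b', fun p => ?_⟩
    rw [hb', hb]
    exact (coeFn_tensorLp _).trans (ae_eq_fintype_prod fun i => hφ i _)
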